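/- Let $(a_n)_{n\in\mathbb{Z}}$ be independent, identically distributed real random variables on a probability space $(\Omega,\mathcal{F},\mathbb{P})$, and suppose there are constants $0<a_-\le a_+<\infty$ such that, almost surely, $a_-\le a_n\le a_+$ for all $n\in\mathbb{Z}$. Let $H_\omega$ be the random Jacobi operator (the div-grad model) \[ (H_\omega\phi)_n=-a_{n+1}\phi_{n+1}+(a_{n+1}+a_n)\phi_n-a_n\phi_{n-1},\qquad n\in\mathbb{Z}. \] For $N\ge 1$ let $H_{N,\omega}$ be the restriction of $H_\omega$ to $\{0,\dots,N-1\}$ with Dirichlet boundary conditions $\psi_{-1}=\psi_N=0$, and let $E_1^N(\omega)\le\dots\le E_N^N(\omega)$ be its eigenvalues, counted with multiplicity. Then for every $E\in\mathbb{R}$ the limit \[ \mathcal{N}(E)=\lim_{N\to\infty}\frac1N\,\#\{\,j: E_j^N(\omega)\le E\,\} \] exists almost surely and is non-random, and the function $\mathcal{N}$ so defined (the integrated density of states of $H_\omega$) satisfies \[ \mathcal{N}(E)=\frac{1}{\pi\sqrt{\kappa}}\sqrt{E}+O(E)\qquad\text{as }E\to0^+,\qquad \kappa=\big[\mathbb{E}(a_0^{-1})\big]^{-1}.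 \] -/

import Mathlib

open MeasureTheory ProbabilityTheory Filter Topology Asymptotics

namespace DivGrad

/-- The div-grad (divergence-gradient) Jacobi operator with coefficients `a`, acting on sequences
indexed by `ℤ`. -/
def op (a : ℤ → ℝ) (φ : ℤ → ℝ) : ℤ → ℝ := fun n =>
  -(a (n + 1) * φ (n + 1)) + (a (n + 1) + a n) * φ n - a n * φ (n - 1)

/-- The restriction of the div-grad operator to the interval `[0, N - 1]` with Dirichlet boundary
conditions `ψ (-1) = ψ N = 0`, as a matrix: the `(i, j)` entry is `(op a δ_j) i`. -/
def boxMatrix (a : ℤ → ℝ) (N : ℕ) : Matrix (Fin N) (Fin N) ℝ :=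
  Matrix.of fun i j => op a (Pi.single (j : ℤ) 1) (i : ℤ)

theorem boxMatrix_isHermitian (a : ℤ → ℝ) (N : ℕ) : (boxMatrix a N).IsHermitian := by
  ext i j
  simp only [boxMatrix, op, Matrix.conjTranspose_apply, Matrix.of_apply, star_trivial,
    Pi.single_apply]
  rcases lt_trichotomy (i : ℤ) (j : ℤ) with h | h | h
  · by_cases h1 : (j : ℤ) = i + 1
    · simp [h1, show ¬ ((i : ℤ) + 1 + 1 = i) by omega, show ¬ ((i : ℤ) - 1 = i + 1) by omega]
    · simp [show ¬ ((j : ℤ) + 1 = i) by omega, show ¬ ((j : ℤ) = i) by omega,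
        show ¬ ((j : ℤ) - 1 = i) by omega, show ¬ ((i : ℤ) + 1 = j) by omega,
        show ¬ ((i : ℤ) = j) by omega, show ¬ ((i : ℤ) - 1 = j) by omega]
  · simp [h]
  · by_cases h1 : (i : ℤ) = j + 1
    · simp [h1, show ¬ ((j : ℤ) + 1 + 1 = j) by omega, show ¬ ((j : ℤ) - 1 = j + 1) by omega]
    · simp [show ¬ ((j : ℤ) + 1 = i) by omega, show ¬ ((j : ℤ) = i) by omega,
        show ¬ ((j : ℤ) - 1 = i) by omega, show ¬ ((i : ℤ) + 1 = j) by omega,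
        show ¬ ((i : ℤ) = j) by omega, show ¬ ((i : ℤ) - 1 = j) by omega]

/-- The number of eigenvalues, counted with multiplicity, of the restriction to `[0, N - 1]` that
are at most `E`. -/
noncomputable def eigCount (a : ℤ → ℝ) (N : ℕ) (E : ℝ) : ℕ :=
  Nat.card {j : Fin N // (boxMatrix_isHermitian a N).eigenvalues j ≤ E}

/-- `𝒩` is the integrated density of states of the random div-grad operator with coefficients
`a n ω`: for every energy `E`, the number `𝒩 E` is the almost sure limit of the normalized
eigenvalue counts of the restrictions to `[0, N - 1]`. -/
def IsIDS {Ω : Type*} [MeasurableSpace Ω] (μ : Measure Ω) (a : ℤ → Ω → ℝ) (𝒩 : ℝ → ℝ) : Prop :=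
  ∀ E : ℝ, ∀ᵐ ω ∂μ,
    Tendsto (fun N : ℕ => (eigCount (fun n => a n ω) N E : ℝ) / (N : ℝ)) atTop (𝓝 (𝒩 E))

/-- The harmonic mean `κ = (𝔼[a₀⁻¹])⁻¹`. -/
noncomputable def kappa {Ω : Type*} [MeasurableSpace Ω] (μ : Measure Ω) (a : ℤ → Ω → ℝ) : ℝ :=
  (∫ ω, (a 0 ω)⁻¹ ∂μ)⁻¹

end DivGrad

/-! Sturm oscillation replaces the count of eigenvalues at most `E` by the count of sign changes of
a solution `u` of the eigenvalue equation. With the flux v_n = a_n (u_n - u_{n-1}), completing the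
square writes the form of H_N - E, on vectors with ψ_0 = 0, as a sum over edges of a_{n+1} u_n
u_{n+1} (ψ_{n+1}/u_{n+1} - ψ_n/u_n)² (zeros of `u` are treated separately). Only edges with a sign
change contribute negatively. Forbidding jumps of ψ/u there makes the form nonnegative; forbidding
them on all other edges makes it nonpositive. Hence the two counts differ by at most one, for every
nontrivial solution (`eigCount_le`, `crossings_le_eigCount`).

Since any solution will do, restarting it at a given point changes the count by at most two. Counts
over disjoint blocks are i.i.d., so Fekete's lemma for the means and the strong law over blocks give
a non-random density (`exists_tendsto_freeCrossings`).

For the asymptotics, put E = ε²κ and follow the vector (v/(εκ), u) with angle θ_n. One step turns it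
by ε(1 + (κ/a_{n+1} - 1) cos² θ_n) + O(ε²) (`exists_rotation`), and each half turn is a sign change.
As θ_n depends only on a_1, …, a_n and κ/a_{n+1} has mean one, the fluctuation has mean exactly zero
(`integral_fluctuation_eq_zero`). So π𝒩(E) = ε + O(ε²) with ε² = E/κ. -/

namespace DivGrad

/-! ### Eigenvalue counts from the sign of the form under linear constraints -/

open Matrix in
/-- Fewer linear constraints than eigenvectors selected by `p` leave a nonzero combination of
these eigenvectors; its quadratic form and its image are computed in the eigenbasis. -/
theorem exists_combination_eigenvectors {n ι : Type*} [Fintype n] [DecidableEq n] [Fintype ι]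
    {A : Matrix n n ℝ} (hA : A.IsHermitian) (p : n → Prop) (L : (n → ℝ) →ₗ[ℝ] (ι → ℝ))
    (h : Fintype.card ι < Nat.card {j // p j}) (E : ℝ) :
    ∃ (φ : n → ℝ) (c : n → ℝ), φ ≠ 0 ∧ L φ = 0 ∧ c ≠ 0 ∧ (∀ j, c j ≠ 0 → p j) ∧
      φ ⬝ᵥ (A *ᵥ φ) - E * (φ ⬝ᵥ φ) = ∑ j, c j ^ 2 * (hA.eigenvalues j - E) ∧
      A *ᵥ φ - E • φ = ∑ j, (c j * (hA.eigenvalues j - E)) • (hA.eigenvectorBasis j).ofLp := by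
  classical
  set e : n → n → ℝ := fun j => (hA.eigenvectorBasis j).ofLp with he
  have hdot : ∀ i j, e i ⬝ᵥ e j = if i = j then 1 else 0 := by
    intro i j
    have := orthonormal_iff_ite.1 hA.eigenvectorBasis.orthonormal j i
    rw [EuclideanSpace.inner_eq_star_dotProduct] at this
    simpa [he, eq_comm] using this
  have hmul : ∀ j, A *ᵥ e j = hA.eigenvalues j • e j := hA.mulVec_eigenvectorBasis
  let M : ({j // p j} → ℝ) →ₗ[ℝ] (n → ℝ) :=
    Fintype.linearCombination ℝ (fun j : {j // p j} => e j)
  have hlt : Module.finrank ℝ (ι → ℝ) < Module.finrank ℝ ({j // p j} → ℝ) := by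
    simpa [Nat.card_eq_fintype_card] using h
  obtain ⟨d, hd, hd0⟩ := Submodule.exists_mem_ne_zero_of_ne_bot
    (LinearMap.ker_ne_bot_of_finrank_lt (f := L ∘ₗ M) hlt)
  let c : n → ℝ := fun j => if hj : p j then d ⟨j, hj⟩ else 0
  have hM : M d = ∑ j, c j • e j := by
    have h1 : ∑ j, c j • e j = ∑ j with p j, c j • e j := by
      rw [Finset.sum_filter]
      refine Finset.sum_congr rfl fun j _ => ?_
      by_cases hj : p j <;> simp [c, hj]
    rw [h1, ← Finset.sum_subtype_eq_sum_filter]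
    simp only [M, Fintype.linearCombination_apply, Finset.subtype_univ]
    refine Finset.sum_congr rfl fun j _ => ?_
    simp [c, j.2]
  have hc0 : c ≠ 0 := by
    intro hc
    apply hd0
    ext j
    have := congrFun hc j
    simpa [c, j.2] using this
  have hsum : ∀ f g : n → ℝ, (∑ j, f j • e j) ⬝ᵥ (∑ j, g j • e j) = ∑ j, f j * g j := by
    intro f g
    simp [sum_dotProduct, dotProduct_sum, hdot, mul_comm]
  have himg : A *ᵥ M d - E • M d = ∑ j, (c j * (hA.eigenvalues j - E)) • e j := by
    rw [hM, mulVec_sum, Finset.smul_sum, ← Finset.sum_sub_distrib]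
    refine Finset.sum_congr rfl fun j _ => ?_
    rw [mulVec_smul, hmul, smul_smul, smul_smul, ← sub_smul]
    congr 1
    ring
  refine ⟨M d, c, ?_, hd, hc0, ?_, ?_, himg⟩
  · intro h0
    have h1 := hsum c c
    rw [← hM, h0, dotProduct_zero] at h1
    apply hc0
    ext j
    have := (Finset.sum_eq_zero_iff_of_nonneg (fun i _ => mul_self_nonneg (c i))).1 h1.symm j
      (Finset.mem_univ j)
    simpa using this
  · intro j hj
    by_contra hp
    exact hj (by simp [c, hp])
  · have : M d ⬝ᵥ (A *ᵥ M d) - E * (M d ⬝ᵥ M d) = M d ⬝ᵥ (A *ᵥ M d - E • M d) := by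
      rw [dotProduct_sub, dotProduct_smul, smul_eq_mul]
    rw [this, himg, hM, hsum]
    refine Finset.sum_congr rfl fun j _ => ?_
    ring

open Matrix in
/-- If the form of `A - E` is nonnegative on the kernel of `L`, and that kernel contains no
eigenvector at `E`, then at most `card ι` eigenvalues of `A` are at most `E`. -/
theorem card_eigenvalues_le_of_nonneg {n ι : Type*} [Fintype n] [DecidableEq n] [Fintype ι]
    {A : Matrix n n ℝ} (hA : A.IsHermitian) (L : (n → ℝ) →ₗ[ℝ] (ι → ℝ)) (E : ℝ)
    (hQ : ∀ φ, L φ = 0 → E * (φ ⬝ᵥ φ) ≤ φ ⬝ᵥ (A *ᵥ φ))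
    (hker : ∀ φ, L φ = 0 → A *ᵥ φ = E • φ → φ = 0) :
    Nat.card {j // hA.eigenvalues j ≤ E} ≤ Fintype.card ι := by
  by_contra! h
  obtain ⟨φ, c, hφ, hL, -, hc, hform, himg⟩ :=
    exists_combination_eigenvectors hA (fun j => hA.eigenvalues j ≤ E) L h E
  have hle : ∀ j ∈ Finset.univ, c j ^ 2 * (hA.eigenvalues j - E) ≤ 0 := by
    intro j _
    by_cases hj : c j = 0
    · simp [hj]
    · exact mul_nonpos_of_nonneg_of_nonpos (sq_nonneg _) (sub_nonpos.2 (hc j hj))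
  -- The two opposite signs force every term to vanish, so `φ` is itself an eigenvector at `E`; this
  -- is the borderline case that `hker` excludes.
  have hzero : ∑ j, c j ^ 2 * (hA.eigenvalues j - E) = 0 :=
    le_antisymm (Finset.sum_nonpos hle) (by rw [← hform]; exact sub_nonneg.2 (hQ φ hL))
  have hall := (Finset.sum_eq_zero_iff_of_nonpos hle).1 hzero
  refine hφ (hker φ hL (sub_eq_zero.1 ?_))
  rw [himg]
  refine Finset.sum_eq_zero fun j hj => ?_
  have : c j * (hA.eigenvalues j - E) = 0 := by
    have := hall j hj
    simpa using this
  rw [this, zero_smul]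

open Matrix in
/-- If the form of `A - E` is nonpositive on the kernel of `L`, then all but at most `card ι`
eigenvalues of `A` are at most `E`. -/
theorem card_le_card_eigenvalues_add_of_nonpos {n ι : Type*} [Fintype n] [DecidableEq n]
    [Fintype ι] {A : Matrix n n ℝ} (hA : A.IsHermitian) (L : (n → ℝ) →ₗ[ℝ] (ι → ℝ)) (E : ℝ)
    (hQ : ∀ φ, L φ = 0 → φ ⬝ᵥ (A *ᵥ φ) ≤ E * (φ ⬝ᵥ φ)) :
    Fintype.card n ≤ Nat.card {j // hA.eigenvalues j ≤ E} + Fintype.card ι := by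
  classical
  have hcompl : Nat.card {j // hA.eigenvalues j ≤ E} + Nat.card {j // ¬ hA.eigenvalues j ≤ E} =
      Fintype.card n := by
    rw [Nat.card_eq_fintype_card, Nat.card_eq_fintype_card, Fintype.card_subtype_compl]
    have := Fintype.card_subtype_le (fun j => hA.eigenvalues j ≤ E)
    omega
  by_contra! h
  obtain ⟨φ, c, hφ, hL, hc0, hc, hform, -⟩ :=
    exists_combination_eigenvectors hA (fun j => ¬ hA.eigenvalues j ≤ E) L (by omega) E
  have hpos : 0 < ∑ j, c j ^ 2 * (hA.eigenvalues j - E) := by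
    obtain ⟨i, hi⟩ := Function.ne_iff.1 hc0
    refine Finset.sum_pos' (fun j _ => ?_) ⟨i, Finset.mem_univ i, ?_⟩
    · by_cases hj : c j = 0
      · simp [hj]
      · exact mul_nonneg (sq_nonneg _) (sub_nonneg.2 (not_le.1 (hc j hj)).le)
    · exact mul_pos (sq_pos_of_ne_zero hi) (sub_pos.2 (not_le.1 (hc i hi)))
  rw [← hform] at hpos
  linarith [hQ φ hL]

/-! ### The quadratic form of the box -/

/-- Extension by zero of a vector on the box `[0, N - 1]`, as a linear map. -/
def zeroExtend (N : ℕ) : (Fin N → ℝ) →ₗ[ℝ] (ℤ → ℝ) where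
  toFun φ k := ∑ j : Fin N, φ j * (Pi.single (j : ℤ) 1 : ℤ → ℝ) k
  map_add' φ χ := by ext k; simp [add_mul, Finset.sum_add_distrib]
  map_smul' c φ := by ext k; simp [mul_assoc, Finset.mul_sum]

theorem zeroExtend_apply {N : ℕ} (φ : Fin N → ℝ) (k : ℤ) :
    zeroExtend N φ k = ∑ j : Fin N, φ j * (Pi.single (j : ℤ) 1 : ℤ → ℝ) k := rfl

theorem zeroExtend_coe {N : ℕ} (φ : Fin N → ℝ) (i : Fin N) : zeroExtend N φ (i : ℤ) = φ i := by
  rw [zeroExtend_apply, Finset.sum_eq_single i]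
  · simp
  · intro j _ hj
    have : (i : ℤ) ≠ (j : ℤ) := by
      intro h
      exact hj (Fin.ext (by exact_mod_cast h.symm))
    simp [this]
  · simp

theorem zeroExtend_of_neg {N : ℕ} (φ : Fin N → ℝ) {k : ℤ} (hk : k < 0) :
    zeroExtend N φ k = 0 := by
  rw [zeroExtend_apply]
  refine Finset.sum_eq_zero fun j _ => ?_
  simp [show k ≠ (j : ℤ) by omega]

theorem zeroExtend_of_le {N : ℕ} (φ : Fin N → ℝ) {k : ℤ} (hk : (N : ℤ) ≤ k) :
    zeroExtend N φ k = 0 := by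
  rw [zeroExtend_apply]
  refine Finset.sum_eq_zero fun j _ => ?_
  simp [show k ≠ (j : ℤ) by omega]

theorem boxMatrix_mulVec (a : ℤ → ℝ) {N : ℕ} (φ : Fin N → ℝ) (i : Fin N) :
    (boxMatrix a N).mulVec φ i = op a (zeroExtend N φ) i := by
  simp only [Matrix.mulVec, dotProduct, boxMatrix, Matrix.of_apply, op, zeroExtend_apply,
    Finset.mul_sum, ← Finset.sum_neg_distrib, ← Finset.sum_add_distrib, ← Finset.sum_sub_distrib]
  refine Finset.sum_congr rfl fun j _ => ?_
  ring

theorem form_boxMatrix (a : ℤ → ℝ) (E : ℝ) {N : ℕ} (φ : Fin N → ℝ) :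
    φ ⬝ᵥ ((boxMatrix a N).mulVec φ) - E * (φ ⬝ᵥ φ) =
      ∑ n ∈ Finset.range N, zeroExtend N φ n * (op a (zeroExtend N φ) n - E * zeroExtend N φ n) := by
  rw [← Fin.sum_univ_eq_sum_range
    (fun n => zeroExtend N φ n * (op a (zeroExtend N φ) n - E * zeroExtend N φ n))]
  simp only [dotProduct, Finset.mul_sum, ← Finset.sum_sub_distrib]
  refine Finset.sum_congr rfl fun i _ => ?_
  rw [boxMatrix_mulVec, zeroExtend_coe]
  ring

/-- Summation by parts for the div-grad form, with free boundary terms. -/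
theorem sum_mul_op (a ψ : ℤ → ℝ) (N : ℕ) :
    ∑ n ∈ Finset.range N, ψ n * op a ψ n =
      ∑ n ∈ Finset.range N, a (n + 1) * (ψ (n + 1) - ψ n) ^ 2 +
        ψ 0 * (a 0 * (ψ 0 - ψ (-1))) - ψ N * (a N * (ψ N - ψ (N - 1))) := by
  induction N with
  | zero => simp
  | succ N ih =>
    rw [Finset.sum_range_succ, Finset.sum_range_succ, ih]
    simp only [op]
    push_cast
    rw [show (N : ℤ) + 1 - 1 = N by ring]
    ring

/-! ### Sturm oscillation: sign changes against eigenvalues -/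

/-- A nontrivial solution of the eigenvalue equation at energy `E` on the half line, as the pair
of the solution `u` and its flux `v n = a n * (u n - u (n - 1))`. -/
structure IsSolution (a : ℤ → ℝ) (E : ℝ) (u v : ℕ → ℝ) : Prop where
  flux : ∀ n, v (n + 1) = v n - E * u n
  grad : ∀ n : ℕ, a (n + 1) * (u (n + 1) - u n) = v (n + 1)
  nontrivial : ∀ n, u n ≠ 0 ∨ v n ≠ 0

open Classical in
/-- The set of positions below `N` at which `u` changes sign; a zero counts at the preceding
position. -/
noncomputable def crossingSet (u : ℕ → ℝ) (N : ℕ) : Finset ℕ :=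
  {n ∈ Finset.range N | u n ≠ 0 ∧ u n * u (n + 1) ≤ 0}

theorem mem_crossingSet {u : ℕ → ℝ} {N n : ℕ} :
    n ∈ crossingSet u N ↔ n < N ∧ u n ≠ 0 ∧ u n * u (n + 1) ≤ 0 := by
  simp [crossingSet]

/-- The number of sign changes of `u` on `[0, N]`. -/
noncomputable def crossings (u : ℕ → ℝ) (N : ℕ) : ℕ := (crossingSet u N).card

theorem crossings_le (u : ℕ → ℝ) (N : ℕ) : crossings u N ≤ N := by
  classical
  simpa [crossings, crossingSet] using
    Finset.card_filter_le (Finset.range N) (fun n => u n ≠ 0 ∧ u n * u (n + 1) ≤ 0)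

open Classical in
theorem crossings_eq_sum (u : ℕ → ℝ) (N : ℕ) :
    crossings u N = ∑ n ∈ Finset.range N, if u n ≠ 0 ∧ u n * u (n + 1) ≤ 0 then 1 else 0 := by
  simp [crossings, crossingSet]

theorem crossings_add (u : ℕ → ℝ) (m n : ℕ) :
    crossings u (m + n) = crossings u m + crossings (fun k => u (m + k)) n := by
  simp only [crossings_eq_sum, Finset.sum_range_add, add_assoc]

/-- The defect in completing the square along the edge `(n, n + 1)`. -/
noncomputable def edgeForm (a : ℤ → ℝ) (E : ℝ) (u v : ℕ → ℝ) (ψ : ℤ → ℝ) (n : ℕ) : ℝ :=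
  a (n + 1) * (ψ (n + 1) - ψ n) ^ 2 - E * ψ n ^ 2
    - (ψ (n + 1) ^ 2 * (v (n + 1) / u (n + 1)) - ψ n ^ 2 * (v n / u n))

/-- The subtracted terms telescope, and both ends vanish because ψ is zero at `0` and at `N`. The
condition at `0` also removes `a 0` from the form, which leaves the initial data of the solution
free. -/
theorem form_eq_sum_edgeForm (a : ℤ → ℝ) (E : ℝ) (u v : ℕ → ℝ) {N : ℕ} (φ : Fin N → ℝ)
    (h0 : zeroExtend N φ 0 = 0) :
    φ ⬝ᵥ ((boxMatrix a N).mulVec φ) - E * (φ ⬝ᵥ φ) =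
      ∑ n ∈ Finset.range N, edgeForm a E u v (zeroExtend N φ) n := by
  set ψ := zeroExtend N φ with hψ
  have hN : ψ N = 0 := zeroExtend_of_le φ le_rfl
  have htel : ∑ n ∈ Finset.range N,
      (ψ (n + 1) ^ 2 * (v (n + 1) / u (n + 1)) - ψ n ^ 2 * (v n / u n)) = 0 := by
    have := Finset.sum_range_sub (fun n : ℕ => ψ n ^ 2 * (v n / u n)) N
    push_cast at this
    rw [this, hN, h0]
    simp
  have hsum := sum_mul_op a ψ N
  rw [h0, hN] at hsum
  rw [form_boxMatrix, ← hψ]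
  simp only [edgeForm, Finset.sum_sub_distrib, mul_sub] at htel ⊢
  rw [hsum, htel]
  simp only [zero_mul, add_zero, sub_zero]
  congr 1
  refine Finset.sum_congr rfl fun n _ => ?_
  ring

namespace IsSolution

variable {a : ℤ → ℝ} {E : ℝ} {u v : ℕ → ℝ}

theorem shift (h : IsSolution a E u v) (m : ℕ) :
    IsSolution (fun k => a (m + k)) E (fun k => u (m + k)) (fun k => v (m + k)) where
  flux n := h.flux (m + n)
  grad n := by
    have := h.grad (m + n)
    push_cast at this
    simpa only [add_assoc] using this
  nontrivial n := h.nontrivial (m + n)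

theorem succ_ne_zero (h : IsSolution a E u v) {n : ℕ} (hn : u n = 0) : u (n + 1) ≠ 0 := by
  intro h1
  have hv := h.grad n
  rw [h1, hn] at hv
  rcases h.nontrivial (n + 1) with h2 | h2
  · exact h2 h1
  · exact h2 (by rw [← hv]; ring)

/-- A discrete Picone identity: expressing both fluxes through `u` leaves a square, with the sign of
`u n * u (n + 1)`. -/
theorem edgeForm_of_ne_zero (h : IsSolution a E u v) (ψ : ℤ → ℝ) {n : ℕ} (h0 : u n ≠ 0)
    (h1 : u (n + 1) ≠ 0) :
    edgeForm a E u v ψ n =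
      a (n + 1) * (u n * u (n + 1)) * (ψ (n + 1) / u (n + 1) - ψ n / u n) ^ 2 := by
  have hv := h.grad n
  have hv' : v n = a (n + 1) * (u (n + 1) - u n) + E * u n := by
    rw [hv, h.flux n]; ring
  rw [edgeForm, ← hv, hv']
  field_simp
  ring

/-- At a zero of `u` the quotient `v / u` takes the default value `0`; this is harmless because `ψ`
vanishes there too. -/
theorem edgeForm_of_zero (h : IsSolution a E u v) (ψ : ℤ → ℝ) {n : ℕ}
    (hψ0 : u n = 0 → ψ n = 0) (hψ1 : u (n + 1) = 0 → ψ (n + 1) = 0)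
    (h0 : u n = 0 ∨ u (n + 1) = 0) : edgeForm a E u v ψ n = 0 := by
  have hv := h.grad n
  have hv' : v n = a (n + 1) * (u (n + 1) - u n) + E * u n := by
    rw [hv, h.flux n]; ring
  rw [edgeForm, ← hv, hv']
  rcases h0 with h0 | h0
  · have h1 := h.succ_ne_zero h0
    rw [hψ0 h0, h0]
    field_simp
    ring
  · have h1 : u n ≠ 0 := fun h2 => h.succ_ne_zero h2 h0
    rw [hψ1 h0, h0]
    field_simp
    ring

/-- The edge form vanishes where `ψ / u` does not jump. -/
theorem edgeForm_of_matched (h : IsSolution a E u v) (ψ : ℤ → ℝ) {n : ℕ}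
    (hψ0 : u n = 0 → ψ n = 0) (hψ1 : u (n + 1) = 0 → ψ (n + 1) = 0)
    (hm : ψ (n + 1) * u n = ψ n * u (n + 1)) : edgeForm a E u v ψ n = 0 := by
  by_cases h0 : u n = 0
  · exact h.edgeForm_of_zero ψ hψ0 hψ1 (Or.inl h0)
  by_cases h1 : u (n + 1) = 0
  · exact h.edgeForm_of_zero ψ hψ0 hψ1 (Or.inr h1)
  rw [h.edgeForm_of_ne_zero ψ h0 h1, (div_eq_div_iff h1 h0).2 hm]
  ring

/-- The linear constraints `ψ 0 = 0` and `ψ (n + 1) * u n = ψ n * u (n + 1)` for `n ∈ s`. -/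
def constraints (u : ℕ → ℝ) (N : ℕ) (s : Finset ℕ) :
    (Fin N → ℝ) →ₗ[ℝ] (Option s → ℝ) where
  toFun φ o := o.elim (zeroExtend N φ 0) fun n =>
    zeroExtend N φ ((n : ℕ) + 1) * u n - zeroExtend N φ (n : ℕ) * u (n + 1)
  map_add' φ χ := by
    ext o
    cases o
    · simp
    · simp; ring
  map_smul' c φ := by
    ext o
    cases o
    · simp
    · simp; ring

theorem constraints_eq_zero {N : ℕ} {s : Finset ℕ} {φ : Fin N → ℝ}
    (hφ : constraints u N s φ = 0) :
    zeroExtend N φ 0 = 0 ∧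
      ∀ n ∈ s, zeroExtend N φ ((n : ℕ) + 1) * u n = zeroExtend N φ (n : ℕ) * u (n + 1) :=
  ⟨congrFun hφ none, fun n hn => sub_eq_zero.1 (congrFun hφ (some ⟨n, hn⟩))⟩

theorem card_option_coe (s : Finset ℕ) : Fintype.card (Option s) = s.card + 1 := by simp

/-- A Dirichlet eigenvector is determined by its first entry. -/
theorem eigenvector_eq_zero (ha : ∀ n, 0 < a n) {N : ℕ} {φ : Fin N → ℝ}
    (h0 : zeroExtend N φ 0 = 0) (hφ : (boxMatrix a N).mulVec φ = E • φ) : φ = 0 := by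
  have key : ∀ n : ℕ, n ≤ N → zeroExtend N φ n = 0 ∧ zeroExtend N φ ((n : ℤ) - 1) = 0 := by
    intro n
    induction n with
    | zero => exact fun _ => ⟨h0, zeroExtend_of_neg φ (by simp)⟩
    | succ n ih =>
      intro hn
      obtain ⟨h1, h2⟩ := ih (by omega)
      have h3 := congrFun hφ ⟨n, by omega⟩
      rw [boxMatrix_mulVec, Pi.smul_apply, ← zeroExtend_coe φ] at h3
      simp only [op, h1, h2, smul_eq_mul, mul_zero, add_zero, sub_zero, neg_eq_zero,
        mul_eq_zero, (ha _).ne', false_or] at h3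
      push_cast
      exact ⟨h3, by rw [add_sub_cancel_right]; exact h1⟩
  ext i
  rw [← zeroExtend_coe φ]
  exact (key i i.2.le).1

/-- One constraint per sign change removes every negative edge; the extra one is `ψ 0 = 0`. -/
theorem eigCount_le (h : IsSolution a E u v) (ha : ∀ n, 0 < a n) (N : ℕ) :
    eigCount a N E ≤ crossings u N + 1 := by
  rw [crossings, ← card_option_coe]
  refine card_eigenvalues_le_of_nonneg _ (constraints u N (crossingSet u N)) E ?_ ?_
  · intro φ hφ
    obtain ⟨h0, hs⟩ := constraints_eq_zero hφ
    set ψ := zeroExtend N φ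
    -- A zero at `n + 1` is recorded as a crossing at `n`, whose matching constraint then forces `ψ
    -- (n + 1) = 0`.
    have hz : ∀ n : ℕ, n ≤ N → u n = 0 → ψ n = 0 := by
      intro n hn hu
      rcases n with _ | n
      · exact h0
      · have hun : u n ≠ 0 := fun h2 => h.succ_ne_zero h2 hu
        have := hs n (mem_crossingSet.2 ⟨by omega, hun, by simp [hu]⟩)
        rw [hu, mul_zero] at this
        push_cast
        exact (mul_eq_zero.1 this).resolve_right hun
    rw [← sub_nonneg, form_eq_sum_edgeForm a E u v φ h0]
    refine Finset.sum_nonneg fun n hn => ?_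
    have hn := Finset.mem_range.1 hn
    have hz0 := hz n hn.le
    have hz1 := hz (n + 1) hn
    push_cast at hz1
    by_cases hc : n ∈ crossingSet u N
    · exact (h.edgeForm_of_matched ψ hz0 hz1 (hs n hc)).ge
    · by_cases hu : u n = 0
      · exact (h.edgeForm_of_zero ψ hz0 hz1 (Or.inl hu)).ge
      · have hpos : 0 < u n * u (n + 1) := by
          by_contra! hle
          exact hc (mem_crossingSet.2 ⟨hn, hu, hle⟩)
        rw [h.edgeForm_of_ne_zero ψ hu (right_ne_zero_of_mul hpos.ne')]
        exact mul_nonneg (mul_nonneg (ha _).le hpos.le) (sq_nonneg _)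
  · intro φ hφ heig
    exact eigenvector_eq_zero ha (constraints_eq_zero hφ).1 heig

/-- The complementary choice: constraints on the edges without sign change leave only nonpositive
terms. -/
theorem crossings_le_eigCount (h : IsSolution a E u v) (ha : ∀ n, 0 < a n) (N : ℕ) :
    crossings u N ≤ eigCount a N E + 1 := by
  have hcard : (Finset.range N \ crossingSet u N).card + crossings u N = N := by
    have hsub : crossingSet u N ⊆ Finset.range N := fun n hn =>
      Finset.mem_range.2 (mem_crossingSet.1 hn).1
    simpa [crossings] using Finset.card_sdiff_add_card_eq_card hsub
  have hmain := card_le_card_eigenvalues_add_of_nonpos (boxMatrix_isHermitian a N)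
    (constraints u N (Finset.range N \ crossingSet u N)) E ?_
  · rw [card_option_coe, Fintype.card_fin] at hmain
    rw [eigCount]
    omega
  · intro φ hφ
    obtain ⟨h0, hs⟩ := constraints_eq_zero hφ
    set ψ := zeroExtend N φ
    -- A zero at `n` is not a crossing at `n`, so here the constraint on the following edge forces
    -- `ψ n = 0`.
    have hz : ∀ n : ℕ, n ≤ N → u n = 0 → ψ n = 0 := by
      intro n hn hu
      rcases hn.lt_or_eq with hlt | rfl
      · have := hs n (by simp [mem_crossingSet, hlt, hu])
        rw [hu, mul_zero] at this
        exact (mul_eq_zero.1 this.symm).resolve_right (h.succ_ne_zero hu)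
      · exact zeroExtend_of_le φ le_rfl
    rw [← sub_nonpos, form_eq_sum_edgeForm a E u v φ h0]
    refine Finset.sum_nonpos fun n hn => ?_
    have hn' := Finset.mem_range.1 hn
    have hz0 := hz n hn'.le
    have hz1 := hz (n + 1) hn'
    push_cast at hz1
    by_cases hc : n ∈ crossingSet u N
    · obtain ⟨-, hu, hle⟩ := mem_crossingSet.1 hc
      by_cases hu1 : u (n + 1) = 0
      · exact (h.edgeForm_of_zero ψ hz0 hz1 (Or.inr hu1)).le
      · rw [h.edgeForm_of_ne_zero ψ hu hu1]
        exact mul_nonpos_of_nonpos_of_nonneg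
          (mul_nonpos_of_nonneg_of_nonpos (ha _).le hle) (sq_nonneg _)
    · exact (h.edgeForm_of_matched ψ hz0 hz1 (hs n (Finset.mem_sdiff.2 ⟨hn, hc⟩))).le

end IsSolution

/-! ### The free solution and almost additivity -/

/-- The solution with `u 0 = 1` and zero flux at the left end, together with its flux. -/
noncomputable def freeSol (a : ℤ → ℝ) (E : ℝ) : ℕ → ℝ × ℝ
  | 0 => (1, 0)
  | n + 1 => ((freeSol a E n).1 + ((freeSol a E n).2 - E * (freeSol a E n).1) / a (n + 1),
      (freeSol a E n).2 - E * (freeSol a E n).1)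

theorem isSolution_freeSol {a : ℤ → ℝ} (ha : ∀ n, 0 < a n) (E : ℝ) :
    IsSolution a E (fun n => (freeSol a E n).1) (fun n => (freeSol a E n).2) where
  flux n := rfl
  grad n := by
    simp only [freeSol, add_sub_cancel_left]
    rw [mul_div_cancel₀ _ (ha _).ne']
  nontrivial n := by
    induction n with
    | zero => simp [freeSol]
    | succ n ih =>
      by_contra! hcon
      simp only [freeSol] at hcon
      obtain ⟨h1, h2⟩ := hcon
      rw [h2, zero_div, add_zero] at h1
      rw [h1, mul_zero, sub_zero] at h2
      exact ih.elim (fun h => h h1) (fun h => h h2)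

/-- The number of sign changes on `[0, N]` of the solution with zero flux at the left end. -/
noncomputable def freeCrossings (a : ℤ → ℝ) (E : ℝ) (N : ℕ) : ℕ :=
  crossings (fun n => (freeSol a E n).1) N

theorem freeCrossings_le (a : ℤ → ℝ) (E : ℝ) (N : ℕ) : freeCrossings a E N ≤ N :=
  crossings_le _ _

theorem abs_eigCount_sub_freeCrossings_le {a : ℤ → ℝ} (ha : ∀ n, 0 < a n) (E : ℝ) (N : ℕ) :
    |(eigCount a N E : ℝ) - freeCrossings a E N| ≤ 1 := by
  have h1 := (isSolution_freeSol ha E).eigCount_le ha N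
  have h2 := (isSolution_freeSol ha E).crossings_le_eigCount ha N
  rw [← freeCrossings] at h1 h2
  rw [abs_le]
  have h1' : (eigCount a N E : ℝ) ≤ freeCrossings a E N + 1 := by exact_mod_cast h1
  have h2' : (freeCrossings a E N : ℝ) ≤ eigCount a N E + 1 := by exact_mod_cast h2
  constructor <;> linarith

/-- The number of sign changes is additive up to an error of two per splitting point. -/
theorem abs_freeCrossings_add_sub_le {a : ℤ → ℝ} (ha : ∀ n, 0 < a n) (E : ℝ) (m n : ℕ) :
    |(freeCrossings a E (m + n) : ℝ) -
      (freeCrossings a E m + freeCrossings (fun k => a (m + k)) E n)| ≤ 2 := by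
  have ha' : ∀ k : ℤ, 0 < a (m + k) := fun k => ha _
  -- The continued solution and the one restarted at `m` solve the same equation on the second
  -- block, so both counts lie within one of the same eigenvalue count.
  have h := (isSolution_freeSol ha E).shift m
  have h1 := h.eigCount_le ha' n
  have h2 := h.crossings_le_eigCount ha' n
  have h3 := (isSolution_freeSol ha' E).eigCount_le ha' n
  have h4 := (isSolution_freeSol ha' E).crossings_le_eigCount ha' n
  rw [← freeCrossings] at h3 h4
  have h5 : freeCrossings a E (m + n) =
    freeCrossings a E m + crossings (fun k => (freeSol a E (m + k)).1) n := crossings_add _ m n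
  have h6 : freeCrossings a E (m + n) ≤
      freeCrossings a E m + freeCrossings (fun k => a (m + k)) E n + 2 := by omega
  have h7 : freeCrossings a E m + freeCrossings (fun k => a (m + k)) E n ≤
      freeCrossings a E (m + n) + 2 := by omega
  rw [abs_le]
  have h6' : (freeCrossings a E (m + n) : ℝ) ≤
      freeCrossings a E m + freeCrossings (fun k => a (m + k)) E n + 2 := by exact_mod_cast h6
  have h7' : (freeCrossings a E m : ℝ) + freeCrossings (fun k => a (m + k)) E n ≤
      freeCrossings a E (m + n) + 2 := by exact_mod_cast h7
  constructor <;> linarith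

/-! ### Prüfer rotation at low energy -/

/-- One step of the recursion turns the vector `(y, x)` by an angle `δ` in `[0, π)`, known to
second order in `ε`. -/
theorem exists_rotation {x y ε c : ℝ} (hxy : x ≠ 0 ∨ y ≠ 0) (hε : 0 < ε) (hc : 0 ≤ c)
    (hsmall : (1 + 2 * c) * ε ≤ 1 / 2) :
    ∃ ρ δ : ℝ, 0 < ρ ∧ 0 ≤ δ ∧ δ < Real.pi ∧
      y - ε * x = ρ * (y * Real.cos δ - x * Real.sin δ) ∧
      x + ε * c * (y - ε * x) = ρ * (x * Real.cos δ + y * Real.sin δ) ∧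
      |δ - ε * (1 + (c - 1) * (y ^ 2 / (x ^ 2 + y ^ 2)))| ≤ ((1 + 2 * c) ^ 2 + c) * ε ^ 2 := by
  have hcε : 0 ≤ c * ε := mul_nonneg hc hε.le
  have hε1 : ε ≤ 1 / 2 := by nlinarith
  have hr : 0 < x ^ 2 + y ^ 2 := by
    rcases hxy with h | h
    · have := sq_pos_of_ne_zero h; positivity
    · have := sq_pos_of_ne_zero h; positivity
  -- In complex form the step is z ↦ z + d = (1 + w) z, so `δ` is the argument of 1 + w, that is Im
  -- log(1 + w), with leading part Im w.
  set z : ℂ := ⟨y, x⟩ with hz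
  have hzsq : Complex.normSq z = x ^ 2 + y ^ 2 := by
    rw [Complex.normSq_apply]; simp only [hz]; ring
  have hz0 : z ≠ 0 := by
    intro h
    rw [h, map_zero] at hzsq
    exact hr.ne hzsq
  set d : ℂ := ⟨-(ε * x), ε * c * (y - ε * x)⟩ with hd
  set w : ℂ := d / z with hw
  have hxz : |x| ≤ ‖z‖ := Complex.abs_im_le_norm z
  have hyz : |y| ≤ ‖z‖ := Complex.abs_re_le_norm z
  have hdn : ‖d‖ ≤ (1 + 2 * c) * ε * ‖z‖ := by
    refine (Complex.norm_le_abs_re_add_abs_im d).trans ?_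
    have h1 : |d.re| = ε * |x| := by simp [hd, abs_mul, abs_of_pos hε]
    have h2 : |d.im| ≤ ε * c * (|y| + ε * |x|) := by
      simp only [hd]
      rw [abs_mul, abs_of_nonneg (by positivity : 0 ≤ ε * c)]
      refine mul_le_mul_of_nonneg_left ?_ (by positivity)
      refine (abs_sub _ _).trans (le_of_eq ?_)
      rw [abs_mul, abs_of_pos hε]
    have h3 : |y| + ε * |x| ≤ 2 * ‖z‖ := by nlinarith [abs_nonneg x]
    have h4 := mul_le_mul_of_nonneg_left h3 (by positivity : 0 ≤ ε * c)
    have h5 := mul_le_mul_of_nonneg_left hxz hε.le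
    nlinarith
  have hwn : ‖w‖ ≤ (1 + 2 * c) * ε := by
    rw [hw, norm_div]
    exact div_le_of_le_mul₀ (norm_nonneg _) (by positivity) hdn
  have hw2 : ‖w‖ ≤ 1 / 2 := hwn.trans hsmall
  have hwim : w.im = ε * (1 + (c - 1) * (y ^ 2 / (x ^ 2 + y ^ 2)))
      - c * ε ^ 2 * (x * y / (x ^ 2 + y ^ 2)) := by
    rw [hw, Complex.div_im, hzsq]
    simp only [hd, hz]
    field_simp
    ring
  -- The vector never turns backwards: x² + c y² - εc xy is nonnegative for small ε.
  have hwim0 : 0 ≤ w.im := by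
    rw [hw, Complex.div_im, hzsq]
    simp only [hd, hz]
    rw [← sub_div]
    refine div_nonneg ?_ hr.le
    have h1 : ε * c ≤ 1 := by nlinarith
    have h2 : 0 ≤ x ^ 2 + c * y ^ 2 - ε * c * (x * y) := by
      nlinarith [mul_nonneg hc (sq_nonneg (y - ε * x / 2)), mul_nonneg (mul_nonneg hε.le
        (sub_nonneg.2 h1)) (sq_nonneg x), sq_nonneg x]
    nlinarith
  have hwre : 0 < (1 + w).re := by
    have := (abs_le.1 (Complex.abs_re_le_norm w)).1
    simp only [Complex.add_re, Complex.one_re]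
    linarith
  have h1w0 : 1 + w ≠ 0 := by
    intro h
    rw [h] at hwre
    simp at hwre
  have hwz : w * z = d := div_mul_cancel₀ d hz0
  have hre : w.re * y - w.im * x = -(ε * x) := by
    have := congrArg Complex.re hwz
    simpa [hz, hd] using this
  have him : w.re * x + w.im * y = ε * c * (y - ε * x) := by
    have := congrArg Complex.im hwz
    simpa only [hz, hd, Complex.mul_im] using this
  have hcos : ‖1 + w‖ * Real.cos (Complex.arg (1 + w)) = 1 + w.re := by
    simp [Complex.norm_mul_cos_arg]
  have hsin : ‖1 + w‖ * Real.sin (Complex.arg (1 + w)) = w.im := by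
    simp [Complex.norm_mul_sin_arg]
  refine ⟨‖1 + w‖, Complex.arg (1 + w), norm_pos_iff.2 h1w0, ?_, ?_, ?_, ?_, ?_⟩
  · rw [Complex.arg_nonneg_iff]
    simpa using hwim0
  · have := (Complex.abs_arg_lt_pi_div_two_iff.2 (Or.inl hwre))
    linarith [le_abs_self (Complex.arg (1 + w)), Real.pi_pos]
  · linear_combination (-y) * hcos + x * hsin - hre
  · linear_combination (-x) * hcos - y * hsin - him
  -- The error has two sources: (1 + 2c)² ε² bounds the remainder of the logarithm, and cε² bounds
  -- the cross term in `w.im`.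
  · have hlog := Complex.norm_log_one_add_sub_self_le (z := w) (by linarith)
    have hlogim : |Complex.arg (1 + w) - w.im| ≤ ‖w‖ ^ 2 := by
      have h1 := Complex.abs_im_le_norm (Complex.log (1 + w) - w)
      rw [Complex.sub_im, Complex.log_im] at h1
      refine h1.trans (hlog.trans ?_)
      have h2 : (1 - ‖w‖)⁻¹ ≤ 2 := by
        rw [inv_le_comm₀ (by linarith) (by norm_num)]
        linarith
      nlinarith [sq_nonneg ‖w‖]
    have hxy1 : |x * y / (x ^ 2 + y ^ 2)| ≤ 1 := by
      rw [abs_div, abs_of_pos hr, div_le_one hr, abs_le]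
      constructor <;> nlinarith [sq_nonneg (x + y), sq_nonneg (x - y)]
    have hsplit : Complex.arg (1 + w) - ε * (1 + (c - 1) * (y ^ 2 / (x ^ 2 + y ^ 2))) =
        (Complex.arg (1 + w) - w.im) + -(c * ε ^ 2 * (x * y / (x ^ 2 + y ^ 2))) := by
      rw [hwim]; ring
    rw [hsplit]
    refine (abs_add_le _ _).trans ?_
    have h3 : |-(c * ε ^ 2 * (x * y / (x ^ 2 + y ^ 2)))| ≤ c * ε ^ 2 := by
      rw [abs_neg, abs_mul, abs_of_nonneg (by positivity : 0 ≤ c * ε ^ 2)]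
      exact mul_le_of_le_one_right (by positivity) hxy1
    have h4 : ‖w‖ ^ 2 ≤ ((1 + 2 * c) * ε) ^ 2 := pow_le_pow_left₀ (norm_nonneg _) hwn 2
    nlinarith

/-- Turning by `δ` from the angle `τ` crosses the axis exactly when `π ≤ τ + δ`. -/
theorem sin_crossing_iff {τ δ : ℝ} (hτ : 0 ≤ τ) (hτ' : τ < Real.pi) (hδ : 0 ≤ δ)
    (hδ' : δ < Real.pi) :
    (Real.sin τ ≠ 0 ∧ Real.sin τ * Real.sin (τ + δ) ≤ 0) ↔ Real.pi ≤ τ + δ := by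
  rcases hτ.eq_or_lt with rfl | hpos
  -- At angle zero the vector is on the axis; that zero belongs to the preceding position, and a
  -- turn by less than π meets no further one.
  · simp [hδ']
  have hs : 0 < Real.sin τ := Real.sin_pos_of_pos_of_lt_pi hpos hτ'
  refine ⟨fun h => ?_, fun h => ⟨hs.ne', ?_⟩⟩
  · by_contra! hlt
    have := mul_pos hs (Real.sin_pos_of_pos_of_lt_pi (by linarith : 0 < τ + δ) hlt)
    linarith [h.2]
  · refine mul_nonpos_of_nonneg_of_nonpos hs.le ?_
    have h1 : 0 ≤ Real.sin (τ + δ - Real.pi) :=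
      Real.sin_nonneg_of_nonneg_of_le_pi (by linarith) (by linarith)
    rw [Real.sin_sub_pi] at h1
    linarith

/-- Sign changes of `x` count half turns of the vector `(y, x)`. -/
theorem abs_pi_mul_crossings_sub_le {x y c : ℕ → ℝ} {ε C : ℝ} (hε : 0 < ε)
    (hc : ∀ n, 0 ≤ c n) (hcC : ∀ n, c n ≤ C) (hsmall : (1 + 2 * C) * ε ≤ 1 / 2)
    (hx0 : x 0 = 1) (hy0 : y 0 = 0) (hy : ∀ n, y (n + 1) = y n - ε * x n)
    (hx : ∀ n, x (n + 1) = x n + ε * c n * (y n - ε * x n)) (N : ℕ) :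
    |Real.pi * crossings x N -
      ∑ n ∈ Finset.range N, ε * (1 + (c n - 1) * (y n ^ 2 / (x n ^ 2 + y n ^ 2)))| ≤
      Real.pi + N * (((1 + 2 * C) ^ 2 + C) * ε ^ 2) := by
  classical
  -- `τ` is the angle reduced to [0, π), `D` the total rotation, and `r` changes sign at each half
  -- turn. The initial vector (0, 1) has angle π/2.
  have key : ∀ N, ∃ τ r D : ℝ, 0 ≤ τ ∧ τ < Real.pi ∧ r ≠ 0 ∧ y N = r * Real.cos τ ∧
      x N = r * Real.sin τ ∧ τ + Real.pi * crossings x N = Real.pi / 2 + D ∧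
      |D - ∑ n ∈ Finset.range N, ε * (1 + (c n - 1) * (y n ^ 2 / (x n ^ 2 + y n ^ 2)))| ≤
        N * (((1 + 2 * C) ^ 2 + C) * ε ^ 2) := by
    intro N
    induction N with
    | zero =>
      refine ⟨Real.pi / 2, 1, 0, by positivity, by linarith [Real.pi_pos], one_ne_zero, ?_, ?_,
        ?_, ?_⟩ <;> simp [hx0, hy0, crossings_eq_sum]
    | succ N ih =>
      obtain ⟨τ, r, D, hτ, hτ', hr, hyN, hxN, hD, hDle⟩ := ih
      have hne : x N ≠ 0 ∨ y N ≠ 0 := by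
        by_contra! hcon
        rw [hxN, hyN, mul_eq_zero, mul_eq_zero] at hcon
        have h1 := hcon.1.resolve_left hr
        have h2 := hcon.2.resolve_left hr
        have := Real.sin_sq_add_cos_sq τ
        rw [h1, h2] at this
        norm_num at this
      obtain ⟨ρ, δ, hρ, hδ, hδ', hy', hx', hest⟩ := exists_rotation hne hε (hc N)
        ((mul_le_mul_of_nonneg_right (by linarith [hcC N]) hε.le).trans hsmall)
      rw [← hy, hyN, hxN] at hy'
      rw [← hx, hyN, hxN] at hx'
      have hyS : y (N + 1) = r * ρ * Real.cos (τ + δ) := by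
        rw [hy', Real.cos_add]; ring
      have hxS : x (N + 1) = r * ρ * Real.sin (τ + δ) := by
        rw [hx', Real.sin_add]; ring
      have hcross : (x N ≠ 0 ∧ x N * x (N + 1) ≤ 0) ↔ Real.pi ≤ τ + δ := by
        rw [← sin_crossing_iff hτ hτ' hδ hδ', hxN, hxS]
        have h1 : r * Real.sin τ * (r * ρ * Real.sin (τ + δ)) =
          r ^ 2 * ρ * (Real.sin τ * Real.sin (τ + δ)) := by ring
        have h2 : 0 < r ^ 2 * ρ := mul_pos (sq_pos_of_ne_zero hr) hρ
        rw [h1, mul_nonpos_iff_pos_imp_nonpos, mul_ne_zero_iff]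
        constructor
        · rintro ⟨⟨-, h3⟩, h4⟩
          exact ⟨h3, h4.1 h2⟩
        · rintro ⟨h3, h4⟩
          exact ⟨⟨hr, h3⟩, fun _ => h4, fun _ => h2.le⟩
      have hDle' : |D + δ - ∑ n ∈ Finset.range (N + 1),
          ε * (1 + (c n - 1) * (y n ^ 2 / (x n ^ 2 + y n ^ 2)))| ≤
          ((N + 1 : ℕ) : ℝ) * (((1 + 2 * C) ^ 2 + C) * ε ^ 2) := by
        rw [Finset.sum_range_succ, add_sub_add_comm]
        refine (abs_add_le _ _).trans ?_
        have h0 := hc N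
        have h1 : ((1 + 2 * c N) ^ 2 + c N) * ε ^ 2 ≤ ((1 + 2 * C) ^ 2 + C) * ε ^ 2 := by
          have := hcC N
          gcongr
        push_cast
        linarith
      have hcs : crossings x (N + 1) =
          crossings x N + if x N ≠ 0 ∧ x N * x (N + 1) ≤ 0 then 1 else 0 := by
        rw [crossings_eq_sum, crossings_eq_sum, Finset.sum_range_succ]
      by_cases hpi : Real.pi ≤ τ + δ
      · refine ⟨τ + δ - Real.pi, -(r * ρ), D + δ, by linarith, by linarith,
          neg_ne_zero.2 (mul_ne_zero hr hρ.ne'), ?_, ?_, ?_, hDle'⟩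
        · rw [hyS, Real.cos_sub_pi]; ring
        · rw [hxS, Real.sin_sub_pi]; ring
        · rw [hcs, if_pos (hcross.2 hpi)]
          push_cast
          linarith
      · refine ⟨τ + δ, r * ρ, D + δ, by linarith, by linarith, mul_ne_zero hr hρ.ne', hyS, hxS,
          ?_, hDle'⟩
        rw [hcs, if_neg (mt hcross.1 hpi)]
        push_cast
        linarith
  obtain ⟨τ, r, D, hτ, hτ', -, -, -, hD, hDle⟩ := key N
  have h1 : Real.pi * crossings x N - ∑ n ∈ Finset.range N,
      ε * (1 + (c n - 1) * (y n ^ 2 / (x n ^ 2 + y n ^ 2))) = (Real.pi / 2 - τ) +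
      (D - ∑ n ∈ Finset.range N,
        ε * (1 + (c n - 1) * (y n ^ 2 / (x n ^ 2 + y n ^ 2)))) := by
    linarith
  rw [h1]
  refine (abs_add_le _ _).trans (add_le_add ?_ hDle)
  rw [abs_le]
  constructor <;> linarith [Real.pi_pos]

/-- The squared cosine of the Prüfer angle of the free solution, with fluxes in units of `s`. -/
noncomputable def fluxFraction (a : ℤ → ℝ) (E s : ℝ) (n : ℕ) : ℝ :=
  ((freeSol a E n).2 / s) ^ 2 / ((freeSol a E n).1 ^ 2 + ((freeSol a E n).2 / s) ^ 2)

theorem fluxFraction_nonneg (a : ℤ → ℝ) (E s : ℝ) (n : ℕ) : 0 ≤ fluxFraction a E s n := by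
  unfold fluxFraction
  positivity

theorem fluxFraction_le_one (a : ℤ → ℝ) (E s : ℝ) (n : ℕ) : fluxFraction a E s n ≤ 1 :=
  div_le_one_of_le₀ (le_add_of_nonneg_left (sq_nonneg _)) (by positivity)

/-- At energy ε²κ, measuring the flux in units of εκ makes both steps of the recursion of order ε,
with coefficient c = κ/a. -/
theorem abs_pi_mul_freeCrossings_sub_le {a : ℤ → ℝ} {ε κ C : ℝ} (hε : 0 < ε) (hκ : 0 < κ)
    (ha : ∀ n, 0 < a n) (haC : ∀ n, κ / a n ≤ C) (hsmall : (1 + 2 * C) * ε ≤ 1 / 2) (N : ℕ) :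
    |Real.pi * freeCrossings a (ε ^ 2 * κ) N -
      ∑ n ∈ Finset.range N,
        ε * (1 + (κ / a (n + 1) - 1) * fluxFraction a (ε ^ 2 * κ) (ε * κ) n)| ≤
      Real.pi + N * (((1 + 2 * C) ^ 2 + C) * ε ^ 2) := by
  refine abs_pi_mul_crossings_sub_le (x := fun n => (freeSol a (ε ^ 2 * κ) n).1)
    (y := fun n => (freeSol a (ε ^ 2 * κ) n).2 / (ε * κ)) (c := fun n => κ / a (n + 1)) hε
    (fun n => (div_pos hκ (ha _)).le) (fun n => haC _) hsmall rfl (by simp [freeSol]) ?_ ?_ N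
  · intro n
    simp only [freeSol]
    field_simp
  · intro n
    have := ha (n + 1)
    simp only [freeSol]
    field_simp

/-! ### Measurability and dependence on finitely many coefficients -/

theorem measurable_freeSol (E : ℝ) (n : ℕ) : Measurable fun a : ℤ → ℝ => freeSol a E n := by
  induction n with
  | zero => exact measurable_const
  | succ n ih =>
    simp only [freeSol]
    fun_prop

theorem measurable_fluxFraction (E s : ℝ) (n : ℕ) :
    Measurable fun a : ℤ → ℝ => fluxFraction a E s n := by
  have := measurable_freeSol E n
  unfold fluxFraction
  fun_prop

theorem measurable_freeCrossings (E : ℝ) (N : ℕ) :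
    Measurable fun a : ℤ → ℝ => (freeCrossings a E N : ℝ) := by
  classical
  simp only [freeCrossings, crossings_eq_sum, Nat.cast_sum, Nat.cast_ite, Nat.cast_one,
    Nat.cast_zero]
  refine Finset.measurable_sum _ fun n _ => Measurable.ite ?_ measurable_const measurable_const
  have h0 := (measurable_freeSol E n).fst
  have h1 := (measurable_freeSol E (n + 1)).fst
  exact (h0 (measurableSet_singleton 0).compl).inter
    (measurableSet_le (h0.mul h1) measurable_const)

/-- The initial flux is prescribed, so `a 0` never enters. Hence blocks use disjoint sets of
coefficients, and `a (n + 1)` is not used by the angle at `n`. -/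
theorem freeSol_congr {a b : ℤ → ℝ} (E : ℝ) {N : ℕ} (hab : ∀ k ∈ Finset.Ioc (0 : ℤ) N, a k = b k) :
    ∀ n ≤ N, freeSol a E n = freeSol b E n := by
  intro n
  induction n with
  | zero => exact fun _ => rfl
  | succ n ih =>
    intro hn
    simp only [freeSol, ih (by omega), hab ((n : ℤ) + 1) (by simp; omega)]

theorem freeCrossings_congr {a b : ℤ → ℝ} (E : ℝ) {N : ℕ}
    (hab : ∀ k ∈ Finset.Ioc (0 : ℤ) N, a k = b k) : freeCrossings a E N = freeCrossings b E N := by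
  classical
  simp only [freeCrossings, crossings_eq_sum]
  refine Finset.sum_congr rfl fun n hn => ?_
  have hn := Finset.mem_range.1 hn
  rw [freeSol_congr E hab n hn.le, freeSol_congr E hab (n + 1) hn]

theorem monotone_freeCrossings (a : ℤ → ℝ) (E : ℝ) : Monotone (freeCrossings a E) := by
  refine monotone_nat_of_le_succ fun n => ?_
  rw [freeCrossings, freeCrossings, crossings_add]
  omega

theorem freeCrossings_add_le (a : ℤ → ℝ) (E : ℝ) (m n : ℕ) :
    freeCrossings a E (m + n) ≤ freeCrossings a E m + n := by
  rw [freeCrossings, freeCrossings, crossings_add]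
  have := crossings_le (fun k => (freeSol a E (m + k)).1) n
  omega

theorem abs_freeCrossings_sub_sum_blocks_le {a : ℤ → ℝ} (ha : ∀ n, 0 < a n) (E : ℝ) (L k : ℕ) :
    |(freeCrossings a E (k * L) : ℝ) -
      ∑ j ∈ Finset.range k, (freeCrossings (fun i => a ((j * L : ℕ) + i)) E L : ℝ)| ≤ 2 * k := by
  induction k with
  | zero => simp [freeCrossings, crossings_eq_sum]
  | succ k ih =>
    have h := abs_freeCrossings_add_sub_le ha E (k * L) L
    rw [Finset.sum_range_succ, Nat.succ_mul]
    rw [abs_le] at h ih ⊢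
    push_cast at h ih ⊢
    constructor <;> linarith [h.1, h.2, ih.1, ih.2]

/-! ### Independence and existence of the density -/

/-- Functionals of disjoint finite sets of independent coordinates are independent. -/
theorem indepFun_of_dependsOn {Ω : Type*} [MeasurableSpace Ω] {μ : Measure Ω} {a : ℤ → Ω → ℝ}
    (ha_meas : ∀ n, Measurable (a n)) (ha_indep : iIndepFun a μ) {S T : Finset ℤ}
    (hST : Disjoint S T) {F G : (ℤ → ℝ) → ℝ} (hF : Measurable F) (hG : Measurable G)
    (hFS : ∀ b c : ℤ → ℝ, (∀ k ∈ S, b k = c k) → F b = F c)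
    (hGT : ∀ b c : ℤ → ℝ, (∀ k ∈ T, b k = c k) → G b = G c) :
    IndepFun (fun ω => F fun k => a k ω) (fun ω => G fun k => a k ω) μ := by
  classical
  -- Filling in zeros outside `U` makes a functional of whole sequences a measurable function of the
  -- coordinates in `U`.
  have hext : ∀ U : Finset ℤ,
      Measurable fun (x : U → ℝ) (k : ℤ) => if h : k ∈ U then x ⟨k, h⟩ else 0 := by
    intro U
    refine measurable_pi_lambda _ fun k => ?_
    by_cases h : k ∈ U
    · simpa [h] using measurable_pi_apply (⟨k, h⟩ : U)
    · simp [h]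
  have h := (ha_indep.indepFun_finset S T hST ha_meas).comp (hF.comp (hext S)) (hG.comp (hext T))
  convert h using 1
  · ext ω
    exact hFS _ _ fun k hk => by simp [hk]
  · ext ω
    exact hGT _ _ fun k hk => by simp [hk]

/-- An i.i.d. sequence is stationary. -/
theorem identDistrib_shift {Ω : Type*} [MeasurableSpace Ω] {μ : Measure Ω}
    [IsProbabilityMeasure μ] {a : ℤ → Ω → ℝ} (ha_meas : ∀ n, Measurable (a n))
    (ha_indep : iIndepFun a μ) (ha_ident : ∀ n, IdentDistrib (a n) (a 0) μ μ) (m : ℤ) :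
    IdentDistrib (fun ω k => a (m + k) ω) (fun ω k => a k ω) μ μ where
  aemeasurable_fst := (measurable_pi_lambda _ fun k => ha_meas _).aemeasurable
  aemeasurable_snd := (measurable_pi_lambda _ fun k => ha_meas _).aemeasurable
  map_eq := by
    have h1 : iIndepFun (fun k => a (m + k)) μ := ha_indep.precomp (add_right_injective m)
    rw [ha_indep.map_fun_eq_infinitePi_map ha_meas,
      h1.map_fun_eq_infinitePi_map (fun k => ha_meas _)]
    congr 1
    ext1 k
    exact (ha_ident _).map_eq.trans (ha_ident k).map_eq.symm

theorem integrable_freeCrossings {Ω : Type*} [MeasurableSpace Ω] {μ : Measure Ω}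
    [IsProbabilityMeasure μ] {a : ℤ → Ω → ℝ} (ha_meas : ∀ n, Measurable (a n)) (E : ℝ) (N : ℕ) :
    Integrable (fun ω => (freeCrossings (fun k => a k ω) E N : ℝ)) μ := by
  refine Integrable.of_bound ((measurable_freeCrossings E N).comp
    (measurable_pi_lambda _ ha_meas)).aestronglyMeasurable (N : ℝ) (ae_of_all _ fun ω => ?_)
  rw [Real.norm_of_nonneg (Nat.cast_nonneg _)]
  exact_mod_cast freeCrossings_le _ _ _

/-- A sequence that grows at most linearly and is approximately a sum over blocks of length `L`
with convergent averages has nearly the block average as its density. -/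
theorem eventually_abs_div_sub_le {f : ℕ → ℝ} {g : ℕ → ℝ} {L : ℕ} (hL : 0 < L) {m : ℝ}
    (hm0 : 0 ≤ m) (hmL : m ≤ L) (hmono : Monotone f) (hadd : ∀ i j, f (i + j) ≤ f i + j)
    (hblock : ∀ k : ℕ, |f (k * L) - ∑ j ∈ Finset.range k, g j| ≤ 2 * k)
    (hg : Tendsto (fun k : ℕ => (∑ j ∈ Finset.range k, g j) / k) atTop (𝓝 m))
    {η : ℝ} (hη : 0 < η) : ∀ᶠ N : ℕ in atTop, |f N / N - m / L| ≤ 2 / L + η := by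
  have hL' : (0 : ℝ) < L := by exact_mod_cast hL
  have hdiv : Tendsto (fun N : ℕ => N / L) atTop atTop := Nat.tendsto_div_const_atTop hL.ne'
  have hg' := hdiv.eventually
    ((Metric.tendsto_nhds.1 hg (L * η / 2) (by positivity)).and (eventually_gt_atTop 0))
  have hsmall : ∀ᶠ N : ℕ in atTop, 2 * (L : ℝ) / N < η / 2 :=
    (tendsto_const_div_atTop_nhds_zero_nat (2 * (L : ℝ))).eventually_lt_const (by positivity)
  filter_upwards [hg', hsmall, eventually_gt_atTop 0] with N hN hNs hNpos
  obtain ⟨hN, hkpos⟩ := hN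
  -- With N = kL + r, monotonicity and growth control the remainder `r`, and the junction error 2k,
  -- divided by N ≥ kL, is at most 2/L.
  set k := N / L with hk
  have hNk : k * L + N % L = N := by rw [hk, mul_comm]; exact Nat.div_add_mod N L
  have hr : N % L < L := Nat.mod_lt _ hL
  set r := N % L
  have hk' : (0 : ℝ) < k := by exact_mod_cast hkpos
  have hN' : (0 : ℝ) < N := by exact_mod_cast hNpos
  have hNk' : (k : ℝ) * L + r = N := by exact_mod_cast hNk
  have hr' : (r : ℝ) ≤ L := by exact_mod_cast hr.le
  have hr0 : (0 : ℝ) ≤ r := Nat.cast_nonneg r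
  have h1 : f (k * L) ≤ f N := hmono (by omega)
  have h2 : f N ≤ f (k * L) + r := by
    have := hadd (k * L) r
    rwa [hNk] at this
  have h3 := abs_le.1 (hblock k)
  have h4 : |∑ j ∈ Finset.range k, g j - k * m| ≤ k * (L * η / 2) := by
    rw [Real.dist_eq] at hN
    have : ∑ j ∈ Finset.range k, g j - k * m = k * ((∑ j ∈ Finset.range k, g j) / k - m) := by
      field_simp
    rw [this, abs_mul, abs_of_pos hk']
    exact mul_le_mul_of_nonneg_left hN.le hk'.le
  have h4 := abs_le.1 h4
  have hmr : 0 ≤ r * (m / L) ∧ r * (m / L) ≤ L := by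
    refine ⟨by positivity, ?_⟩
    have : m / L ≤ 1 := (div_le_one hL').2 hmL
    nlinarith [div_nonneg hm0 hL'.le]
  have hkm : (k : ℝ) * m = N * (m / L) - r * (m / L) := by
    rw [← hNk']; field_simp; ring
  have h5 : |f N - N * (m / L)| ≤ 2 * L + k * L * (2 / L + η / 2) := by
    have : (k : ℝ) * L * (2 / L + η / 2) = 2 * k + k * (L * η / 2) := by field_simp
    rw [this, abs_le]
    constructor <;> linarith [h3.1, h3.2, h4.1, h4.2, hmr.1, hmr.2]
  have h6 : f N / N - m / L = (f N - N * (m / L)) / N := by field_simp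
  rw [h6, abs_div, abs_of_pos hN', div_le_iff₀ hN']
  have h7 : 2 * (L : ℝ) ≤ η / 2 * N := ((div_lt_iff₀ hN').1 hNs).le
  have h8 : (k : ℝ) * L * (2 / L + η / 2) ≤ N * (2 / L + η / 2) :=
    mul_le_mul_of_nonneg_right (by linarith) (by positivity)
  linarith

/-- The density of sign changes exists almost surely and is the limit of its expectations. -/
theorem exists_tendsto_freeCrossings {Ω : Type*} [MeasurableSpace Ω] {μ : Measure Ω}
    [IsProbabilityMeasure μ] {a : ℤ → Ω → ℝ} (ha_meas : ∀ n, Measurable (a n))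
    (ha_indep : iIndepFun a μ) (ha_ident : ∀ n, IdentDistrib (a n) (a 0) μ μ)
    (ha_pos : ∀ n ω, 0 < a n ω) (E : ℝ) :
    ∃ s : ℝ, Tendsto (fun N : ℕ => (∫ ω, (freeCrossings (fun k => a k ω) E N : ℝ) ∂μ) / N)
        atTop (𝓝 s) ∧
      ∀ᵐ ω ∂μ, Tendsto (fun N : ℕ => (freeCrossings (fun k => a k ω) E N : ℝ) / N)
        atTop (𝓝 s) := by
  set m : ℕ → ℝ := fun N => ∫ ω, (freeCrossings (fun k => a k ω) E N : ℝ) ∂μ with hm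
  have hint := integrable_freeCrossings (μ := μ) ha_meas E
  have hid : ∀ i N : ℕ, IdentDistrib
      (fun ω => (freeCrossings (fun k => a ((i : ℤ) + k) ω) E N : ℝ))
      (fun ω => (freeCrossings (fun k => a k ω) E N : ℝ)) μ μ := fun i N =>
    (identDistrib_shift ha_meas ha_indep ha_ident i).comp (measurable_freeCrossings E N)
  have hm0 : ∀ N, 0 ≤ m N := fun N => integral_nonneg fun ω => Nat.cast_nonneg _
  have hmN : ∀ N, m N ≤ N := by
    intro N
    have : m N ≤ ∫ _, (N : ℝ) ∂μ :=
      integral_mono (hint N) (integrable_const _) fun ω =>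
        Nat.cast_le.2 (freeCrossings_le _ _ _)
    simpa using this
  -- The added 2 absorbs the splitting error, so Fekete's lemma applies.
  have hsub : Subadditive fun N => m N + 2 := by
    intro i j
    have hintj : Integrable (fun ω => (freeCrossings (fun k => a ((i : ℤ) + k) ω) E j : ℝ)) μ :=
      (hid i j).integrable_iff.2 (hint j)
    have h1 : m (i + j) ≤ ∫ ω, ((freeCrossings (fun k => a k ω) E i : ℝ) +
        freeCrossings (fun k => a ((i : ℤ) + k) ω) E j + 2) ∂μ := by
      refine integral_mono (hint _) (((hint i).add hintj).add (integrable_const _)) fun ω => ?_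
      have := (abs_le.1 (abs_freeCrossings_add_sub_le (fun n => ha_pos n ω) E i j)).2
      simp only [] at this ⊢
      linarith
    have h2 := integral_add ((hint i).add hintj) (integrable_const (μ := μ) (2 : ℝ))
    simp only [Pi.add_apply] at h2
    rw [h2, integral_add (hint i) hintj,
      (hid i j).integral_eq] at h1
    simp only [integral_const, probReal_univ, one_smul] at h1
    linarith
  have hlim := hsub.tendsto_lim ⟨0, by
    rintro _ ⟨N, rfl⟩
    have := hm0 N
    positivity⟩
  have hlim' : Tendsto (fun N : ℕ => m N / N) atTop (𝓝 hsub.lim) := by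
    have := hlim.sub (tendsto_const_div_atTop_nhds_zero_nat (2 : ℝ))
    rw [sub_zero] at this
    refine this.congr fun N => ?_
    rw [add_div, add_sub_cancel_right]
  refine ⟨hsub.lim, hlim', ?_⟩
  -- One null set serves all block lengths, since `L` is chosen only after the tolerance.
  have hslln : ∀ᵐ ω ∂μ, ∀ L : ℕ, Tendsto (fun k : ℕ => (∑ j ∈ Finset.range k,
      (freeCrossings (fun i => a (((j * L : ℕ) : ℤ) + i) ω) E L : ℝ)) / k) atTop (𝓝 (m L)) := by
    rw [ae_all_iff]
    intro L
    have hpair : Pairwise (Function.onFun (fun X Y : Ω → ℝ => IndepFun X Y μ)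
        fun j : ℕ => fun ω => (freeCrossings (fun i => a (((j * L : ℕ) : ℤ) + i) ω) E L : ℝ)) := by
      intro i j hij
      have hdep : ∀ (t : ℤ) (b c : ℤ → ℝ), (∀ k ∈ Finset.Ioc t (t + L), b k = c k) →
          (freeCrossings (fun i => b (t + i)) E L : ℝ) = freeCrossings (fun i => c (t + i)) E L := by
        intro t b c hbc
        rw [freeCrossings_congr E fun k hk => hbc (t + k) ?_]
        simp only [Finset.mem_Ioc] at hk ⊢
        omega
      have hmeas : ∀ t : ℤ, Measurable fun b : ℤ → ℝ =>
          (freeCrossings (fun i => b (t + i)) E L : ℝ) := fun t =>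
        (measurable_freeCrossings E L).comp
          (measurable_pi_lambda _ fun i => measurable_pi_apply _)
      refine indepFun_of_dependsOn ha_meas ha_indep ?_ (hmeas _) (hmeas _) (hdep _) (hdep _)
      rw [Finset.disjoint_left]
      intro k hk hk'
      simp only [Finset.mem_Ioc] at hk hk'
      rcases lt_or_gt_of_ne hij with h | h
      · have : ((i + 1) * L : ℕ) ≤ j * L := Nat.mul_le_mul_right L h
        rw [Nat.succ_mul] at this
        omega
      · have : ((j + 1) * L : ℕ) ≤ i * L := Nat.mul_le_mul_right L h
        rw [Nat.succ_mul] at this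
        omega
    have h := strong_law_ae_real (μ := μ) (fun (j : ℕ) ω =>
      (freeCrossings (fun i => a (((j * L : ℕ) : ℤ) + i) ω) E L : ℝ))
      ((hid _ L).integrable_iff.2 (hint L)) hpair
      (fun j => (hid _ L).trans (hid _ L).symm)
    rwa [(hid (0 * L) L).integral_eq] at h
  filter_upwards [hslln] with ω hω
  rw [Metric.tendsto_nhds]
  intro η hη
  obtain ⟨L, hL1, hL2, hL3⟩ := ((Metric.tendsto_nhds.1 hlim' (η / 4) (by positivity)).and
    (((tendsto_const_div_atTop_nhds_zero_nat (2 : ℝ)).eventually_lt_const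
      (by positivity : (0 : ℝ) < η / 4)).and (eventually_gt_atTop 0))).exists
  have hev := eventually_abs_div_sub_le (f := fun N => (freeCrossings (fun k => a k ω) E N : ℝ))
    hL3 (hm0 L) (hmN L)
    (fun i j hij => Nat.cast_le.2 (monotone_freeCrossings _ E hij))
    (fun i j => by exact_mod_cast freeCrossings_add_le _ E i j)
    (fun k => abs_freeCrossings_sub_sum_blocks_le (fun n => ha_pos n ω) E L k) (hω L)
    (by positivity : 0 < η / 4)
  filter_upwards [hev] with N hN
  rw [Real.dist_eq] at hL1 ⊢
  have h1 := abs_sub_le ((freeCrossings (fun k => a k ω) E N : ℝ) / N) (m L / L) hsub.lim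
  linarith

/-! ### The mean rotation -/

theorem integrable_inv {Ω : Type*} [MeasurableSpace Ω] {μ : Measure Ω}
    [IsProbabilityMeasure μ] {a : ℤ → Ω → ℝ} (ha_meas : ∀ n, Measurable (a n)) {aminus : ℝ}
    (hpos : 0 < aminus) (ha : ∀ n ω, aminus ≤ a n ω) (n : ℤ) :
    Integrable (fun ω => (a n ω)⁻¹) μ := by
  refine Integrable.of_bound (ha_meas n).inv.aestronglyMeasurable aminus⁻¹ (ae_of_all _ fun ω => ?_)
  rw [Real.norm_of_nonneg (inv_nonneg.2 (hpos.le.trans (ha n ω)))]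
  exact inv_anti₀ hpos (ha n ω)

theorem kappa_pos {Ω : Type*} [MeasurableSpace Ω] {μ : Measure Ω}
    [IsProbabilityMeasure μ] {a : ℤ → Ω → ℝ} (ha_meas : ∀ n, Measurable (a n)) {aminus : ℝ}
    (hpos : 0 < aminus) (ha : ∀ n ω, aminus ≤ a n ω) : 0 < kappa μ a := by
  have hp : ∀ ω, 0 < (a 0 ω)⁻¹ := fun ω => inv_pos.2 (hpos.trans_le (ha 0 ω))
  rw [kappa, inv_pos, integral_pos_iff_support_of_nonneg (fun ω => (hp ω).le)
    (integrable_inv ha_meas hpos ha 0)]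
  have : Function.support (fun ω => (a 0 ω)⁻¹) = Set.univ :=
    Set.eq_univ_of_forall fun ω => (hp ω).ne'
  rw [this, measure_univ]
  exact one_pos

/-- The fluctuation of the rotation per step has mean zero, since the next coefficient is
independent of the current angle. -/
theorem integral_fluctuation_eq_zero {Ω : Type*} [MeasurableSpace Ω] {μ : Measure Ω}
    [IsProbabilityMeasure μ] {a : ℤ → Ω → ℝ} (ha_meas : ∀ n, Measurable (a n))
    (ha_indep : iIndepFun a μ) (ha_ident : ∀ n, IdentDistrib (a n) (a 0) μ μ) {aminus : ℝ}
    (hpos : 0 < aminus) (ha : ∀ n ω, aminus ≤ a n ω) (E s : ℝ) (n : ℕ) :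
    Integrable (fun ω => (kappa μ a / a (n + 1) ω - 1) * fluxFraction (fun k => a k ω) E s n) μ ∧
    ∫ ω, (kappa μ a / a (n + 1) ω - 1) * fluxFraction (fun k => a k ω) E s n ∂μ = 0 := by
  have hindep : IndepFun (fun ω => kappa μ a / a (n + 1) ω - 1)
      (fun ω => fluxFraction (fun k => a k ω) E s n) μ := by
    refine indepFun_of_dependsOn ha_meas ha_indep (S := {(n : ℤ) + 1}) (T := Finset.Ioc 0 (n : ℤ))
      (by simp) (F := fun b => kappa μ a / b (n + 1) - 1) (G := fun b => fluxFraction b E s n)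
      (by fun_prop) (measurable_fluxFraction E s n) (fun b c hbc => ?_) (fun b c hbc => ?_)
    · simp [hbc]
    · simp only [fluxFraction, freeSol_congr E hbc n le_rfl]
  have hinv := integrable_inv (μ := μ) ha_meas hpos ha (n + 1)
  have hint1 : Integrable (fun ω => kappa μ a / a (n + 1) ω - 1) μ := by
    simp only [div_eq_mul_inv]
    exact (hinv.const_mul _).sub (integrable_const _)
  have hmeas2 : AEStronglyMeasurable (fun ω => fluxFraction (fun k => a k ω) E s n) μ :=
    ((measurable_fluxFraction E s n).comp (measurable_pi_lambda _ ha_meas)).aestronglyMeasurable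
  have hint2 : Integrable (fun ω => fluxFraction (fun k => a k ω) E s n) μ := by
    refine Integrable.of_bound hmeas2 1 (ae_of_all _ fun ω => ?_)
    rw [Real.norm_of_nonneg (fluxFraction_nonneg _ _ _ _)]
    exact fluxFraction_le_one _ _ _ _
  refine ⟨hindep.integrable_mul hint1 hint2, ?_⟩
  have hmean : ∫ ω, (kappa μ a / a (n + 1) ω - 1) ∂μ = 0 := by
    have h1 : ∫ ω, (a (n + 1) ω)⁻¹ ∂μ = ∫ ω, (a 0 ω)⁻¹ ∂μ :=
      ((ha_ident (n + 1)).comp measurable_inv).integral_eq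
    have h2 : kappa μ a * ∫ ω, (a 0 ω)⁻¹ ∂μ = 1 :=
      inv_mul_cancel₀ (inv_pos.1 (kappa_pos ha_meas hpos ha)).ne'
    simp only [div_eq_mul_inv]
    rw [integral_sub (hinv.const_mul _) (integrable_const _), integral_const_mul, h1, h2]
    simp
  rw [hindep.integral_fun_mul_eq_mul_integral hint1.aestronglyMeasurable hmeas2, hmean, zero_mul]

/-- Averaging the pathwise rotation estimate removes the fluctuation and leaves a drift of ε per
step. -/
theorem abs_pi_mul_integral_freeCrossings_sub_le {Ω : Type*} [MeasurableSpace Ω] {μ : Measure Ω}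
    [IsProbabilityMeasure μ] {a : ℤ → Ω → ℝ} (ha_meas : ∀ n, Measurable (a n))
    (ha_indep : iIndepFun a μ) (ha_ident : ∀ n, IdentDistrib (a n) (a 0) μ μ) {aminus : ℝ}
    (hpos : 0 < aminus) (ha : ∀ n ω, aminus ≤ a n ω) {ε C : ℝ} (hε : 0 < ε)
    (hC : kappa μ a / aminus ≤ C) (hsmall : (1 + 2 * C) * ε ≤ 1 / 2) (N : ℕ) :
    |Real.pi * ∫ ω, (freeCrossings (fun k => a k ω) (ε ^ 2 * kappa μ a) N : ℝ) ∂μ - N * ε| ≤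
      Real.pi + N * (((1 + 2 * C) ^ 2 + C) * ε ^ 2) := by
  have hκ := kappa_pos (μ := μ) ha_meas hpos ha
  set κ := kappa μ a with hκdef
  have hfl := integral_fluctuation_eq_zero (μ := μ) ha_meas ha_indep ha_ident hpos ha
    (ε ^ 2 * κ) (ε * κ)
  rw [← hκdef] at hfl
  have hterm : ∀ n : ℕ, Integrable (fun ω => ε * (1 + (κ / a (n + 1) ω - 1) *
      fluxFraction (fun k => a k ω) (ε ^ 2 * κ) (ε * κ) n)) μ := fun n =>
    ((integrable_const _).add (hfl n).1).const_mul ε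
  have hsum : ∫ ω, ∑ n ∈ Finset.range N, ε * (1 + (κ / a (n + 1) ω - 1) *
      fluxFraction (fun k => a k ω) (ε ^ 2 * κ) (ε * κ) n) ∂μ = N * ε := by
    rw [integral_finsetSum _ fun n _ => hterm n]
    have : ∀ n ∈ Finset.range N, ∫ ω, ε * (1 + (κ / a (n + 1) ω - 1) *
        fluxFraction (fun k => a k ω) (ε ^ 2 * κ) (ε * κ) n) ∂μ = ε := by
      intro n _
      rw [integral_const_mul, integral_add (integrable_const _) (hfl n).1, (hfl n).2]
      simp
    rw [Finset.sum_congr rfl this]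
    simp
  rw [← hsum, ← integral_const_mul, ← integral_sub
    ((integrable_freeCrossings ha_meas _ N).const_mul _)
    (integrable_finsetSum _ fun n _ => hterm n), ← Real.norm_eq_abs]
  refine (norm_integral_le_of_norm_le_const (ae_of_all _ fun ω => ?_)).trans_eq
    (by rw [probReal_univ, mul_one])
  rw [Real.norm_eq_abs]
  refine abs_pi_mul_freeCrossings_sub_le (a := fun k => a k ω) hε hκ
    (fun n => hpos.trans_le (ha n ω)) (fun n => ?_) hsmall N
  exact (div_le_div_of_nonneg_left hκ.le hpos (ha n ω)).trans hC

/-! ### The integrated density of states and its asymptotics -/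

/-- The integrated density of states exists and is the limiting mean density of sign changes. -/
theorem exists_isIDS {Ω : Type*} [MeasurableSpace Ω] {μ : Measure Ω}
    [IsProbabilityMeasure μ] {a : ℤ → Ω → ℝ} (ha_meas : ∀ n, Measurable (a n))
    (ha_indep : iIndepFun a μ) (ha_ident : ∀ n, IdentDistrib (a n) (a 0) μ μ)
    (ha_pos : ∀ n ω, 0 < a n ω) :
    ∃ 𝒩 : ℝ → ℝ, IsIDS μ a 𝒩 ∧ ∀ E, Tendsto
      (fun N : ℕ => (∫ ω, (freeCrossings (fun k => a k ω) E N : ℝ) ∂μ) / N) atTop (𝓝 (𝒩 E)) := by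
  choose 𝒩 hmean has using exists_tendsto_freeCrossings ha_meas ha_indep ha_ident ha_pos
  refine ⟨𝒩, fun E => ?_, hmean⟩
  filter_upwards [has E] with ω hω
  have hdiff : Tendsto (fun N : ℕ => ((eigCount (fun n => a n ω) N E : ℝ) -
      freeCrossings (fun k => a k ω) E N) / N) atTop (𝓝 0) := by
    refine squeeze_zero_norm (fun N => ?_) (tendsto_const_div_atTop_nhds_zero_nat (1 : ℝ))
    rw [norm_div, Real.norm_natCast, Real.norm_eq_abs]
    exact div_le_div_of_nonneg_right
      (abs_eigCount_sub_freeCrossings_le (fun n => ha_pos n ω) E N) (Nat.cast_nonneg N)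
  have := hω.add hdiff
  rw [add_zero] at this
  refine this.congr fun N => ?_
  rw [← add_div, add_sub_cancel]

theorem IsIDS.unique {Ω : Type*} [MeasurableSpace Ω] {μ : Measure Ω} [IsProbabilityMeasure μ]
    {a : ℤ → Ω → ℝ} {𝒩 𝒩' : ℝ → ℝ} (h : IsIDS μ a 𝒩) (h' : IsIDS μ a 𝒩') : 𝒩 = 𝒩' := by
  ext E
  obtain ⟨ω, h1, h2⟩ := ((h E).and (h' E)).exists
  exact tendsto_nhds_unique h1 h2

theorem IsIDS.congr_ae {Ω : Type*} [MeasurableSpace Ω] {μ : Measure Ω} {a b : ℤ → Ω → ℝ}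
    (hab : ∀ᵐ ω ∂μ, ∀ n, a n ω = b n ω) {𝒩 : ℝ → ℝ} (h : IsIDS μ a 𝒩) : IsIDS μ b 𝒩 := by
  intro E
  filter_upwards [h E, hab] with ω hω heq
  rwa [funext heq] at hω

theorem isBigO_ids_of_le {Ω : Type*} [MeasurableSpace Ω] {μ : Measure Ω}
    [IsProbabilityMeasure μ] {a : ℤ → Ω → ℝ} (ha_meas : ∀ n, Measurable (a n))
    (ha_indep : iIndepFun a μ) (ha_ident : ∀ n, IdentDistrib (a n) (a 0) μ μ) {aminus : ℝ}
    (hpos : 0 < aminus) (ha : ∀ n ω, aminus ≤ a n ω) {𝒩 : ℝ → ℝ} (h𝒩 : IsIDS μ a 𝒩) :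
    (fun E : ℝ => 𝒩 E - 1 / (Real.pi * √(kappa μ a)) * √E) =O[𝓝[>] 0] (fun E : ℝ => E) := by
  obtain ⟨𝒩', hids, hmean⟩ := exists_isIDS ha_meas ha_indep ha_ident
    fun n ω => hpos.trans_le (ha n ω)
  obtain rfl := hids.unique h𝒩
  have hκ := kappa_pos (μ := μ) ha_meas hpos ha
  set κ := kappa μ a with hκdef
  have hC : 0 ≤ κ / aminus := (div_pos hκ hpos).le
  set C := κ / aminus with hCdef
  refine IsBigO.of_bound (((1 + 2 * C) ^ 2 + C) / (Real.pi * κ)) ?_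
  have hsmall : ∀ᶠ E : ℝ in 𝓝[>] 0, (1 + 2 * C) * (√E / √κ) < 1 / 2 := by
    have hcont : Continuous fun E : ℝ => (1 + 2 * C) * (√E / √κ) := by fun_prop
    have h0 : Tendsto (fun E : ℝ => (1 + 2 * C) * (√E / √κ)) (𝓝[>] 0) (𝓝 0) := by
      have := (hcont.tendsto 0).mono_left (nhdsWithin_le_nhds (s := Set.Ioi 0))
      simpa using this
    exact h0.eventually_lt_const (by norm_num)
  filter_upwards [hsmall, self_mem_nhdsWithin] with E hE hE0
  have hE0 : 0 < E := hE0
  have hsκ : 0 < √κ := Real.sqrt_pos.2 hκ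
  -- This solves E = ε²κ: the main term is ε/π, and an error of order ε² is of order E.
  set ε := √E / √κ with hε
  have hεpos : 0 < ε := div_pos (Real.sqrt_pos.2 hE0) hsκ
  have hεsq : ε ^ 2 = E / κ := by
    rw [hε, div_pow, Real.sq_sqrt hE0.le, Real.sq_sqrt hκ.le]
  have hEε : ε ^ 2 * κ = E := by
    rw [hεsq]; field_simp
  have hbound : |Real.pi * 𝒩' E - ε| ≤ ((1 + 2 * C) ^ 2 + C) * ε ^ 2 := by
    -- With ε fixed, dividing by `N` and letting `N` tend to infinity removes the boundary term π.
    have hlhs := (((hmean E).const_mul Real.pi).sub_const ε).abs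
    have hrhs := (tendsto_const_div_atTop_nhds_zero_nat Real.pi).add_const
      (((1 + 2 * C) ^ 2 + C) * ε ^ 2)
    rw [zero_add] at hrhs
    refine le_of_tendsto_of_tendsto hlhs hrhs ?_
    filter_upwards [eventually_gt_atTop 0] with N hN
    have hN' : (0 : ℝ) < N := by exact_mod_cast hN
    have h := abs_pi_mul_integral_freeCrossings_sub_le (μ := μ) ha_meas ha_indep ha_ident hpos ha
      hεpos (le_refl C) hE.le N
    rw [← hκdef, hEε] at h
    set I := ∫ ω, (freeCrossings (fun k => a k ω) E N : ℝ) ∂μ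
    have h1 : Real.pi * (I / N) - ε = (Real.pi * I - N * ε) / N := by field_simp
    have h2 : Real.pi / N + ((1 + 2 * C) ^ 2 + C) * ε ^ 2 =
        (Real.pi + N * (((1 + 2 * C) ^ 2 + C) * ε ^ 2)) / N := by field_simp
    rw [h1, h2, abs_div, abs_of_pos hN']
    exact div_le_div_of_nonneg_right h hN'.le
  have hpi := Real.pi_pos
  have hlead : 𝒩' E - 1 / (Real.pi * √κ) * √E = (Real.pi * 𝒩' E - ε) / Real.pi := by
    rw [hε]; field_simp
  rw [hlead, Real.norm_eq_abs, Real.norm_eq_abs, abs_div, abs_of_pos hpi, abs_of_pos hE0,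
    div_le_iff₀ hpi]
  refine hbound.trans_eq ?_
  rw [hεsq]
  field_simp

end DivGrad

theorem theorem2p1 {Ω : Type*} [MeasurableSpace Ω] (μ : Measure Ω) [IsProbabilityMeasure μ]
    (a : ℤ → Ω → ℝ) (ha_meas : ∀ n, Measurable (a n))
    (ha_indep : iIndepFun a μ) (ha_ident : ∀ n, IdentDistrib (a n) (a 0) μ μ)
    (aminus aplus : ℝ) (ha_pos : 0 < aminus)
    (ha_bound : ∀ᵐ ω ∂μ, ∀ n, aminus ≤ a n ω ∧ a n ω ≤ aplus) :
    (∃ 𝒩 : ℝ → ℝ, DivGrad.IsIDS μ a 𝒩) ∧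
      ∀ 𝒩 : ℝ → ℝ, DivGrad.IsIDS μ a 𝒩 →
        (fun E : ℝ => 𝒩 E - 1 / (Real.pi * √(DivGrad.kappa μ a)) * √E)
          =O[𝓝[>] 0] (fun E : ℝ => E) := by
  have hmax : Measurable fun x : ℝ => max aminus x := by fun_prop
  -- Truncation makes the lower bound hold for every `ω`. It preserves the i.i.d. property and
  -- changes `a` only on a null set, so `kappa` and the density of states are unaffected.
  let b : ℤ → Ω → ℝ := fun n ω => max aminus (a n ω)
  have hb_meas : ∀ n, Measurable (b n) := fun n => hmax.comp (ha_meas n)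
  have hb_indep : iIndepFun b μ := ha_indep.comp (fun _ x => max aminus x) fun _ => hmax
  have hb_ident : ∀ n, IdentDistrib (b n) (b 0) μ μ := fun n => (ha_ident n).comp hmax
  have hb : ∀ n ω, aminus ≤ b n ω := fun n ω => le_max_left _ _
  have hab : ∀ᵐ ω ∂μ, ∀ n, a n ω = b n ω := by
    filter_upwards [ha_bound] with ω hω n
    exact (max_eq_right (hω n).1).symm
  have hκ : DivGrad.kappa μ a = DivGrad.kappa μ b := by
    unfold DivGrad.kappa
    congr 1
    refine integral_congr_ae ?_
    filter_upwards [hab] with ω hω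
    rw [hω 0]
  refine ⟨?_, fun 𝒩 h𝒩 => ?_⟩
  · obtain ⟨𝒩, h𝒩, -⟩ := DivGrad.exists_isIDS hb_meas hb_indep hb_ident
      fun n ω => ha_pos.trans_le (hb n ω)
    exact ⟨𝒩, h𝒩.congr_ae (hab.mono fun ω hω n => (hω n).symm)⟩
  · rw [hκ]
    exact DivGrad.isBigO_ids_of_le hb_meas hb_indep hb_ident ha_pos hb (h𝒩.congr_ae hab)
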